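/- Let $(\Omega,\mathcal F,\mathbb P)$ be an atomless probability space, $n\in\mathbb N$ and $S\in L^1$. Write $\mathbb A_n(S)$ for the set of clearing allocations, i.e. all $(X_1,\dots,X_n)\in(L^1)^n$ with $\sum_{i=1}^n X_i=S$ a.s., and $\mathbb A_n^+(S)$ for the set of comonotonic ones, i.e. all $(X_1,\dots,X_n)\in\mathbb A_n(S)$ for which there are nondecreasing functions $f_1,\dots,f_n:\mathbb R\to\mathbb R$ with $X_i=f_i(S)$ a.s. for every $i$. For $X,Y\in L^1$ write $Y\le_{\mathrm{cx}}X$ if $\mathbb E[Y]=\mathbb E[X]$ and $\mathbb E[\phi(Y)]\le\mathbb E[\phi(X)]$ (in $\mathbb R\cup\{+\infty\}$) for every convex $\phi:\mathbb R\to\mathbb R$. Let $\mathcal X\subseteq\mathbb A_n(S)$ be nonempty and componentwise convex-order solid: whenever $(X_1,\dots,X_n)\in\mathcal X$, $(Y_1,\dots,Y_n)\in\mathbb A_n(S)$ and $Y_i\le_{\mathrm{cx}}X_i$ for every $i$, then $(Y_1,\dots,Y_n)\in\mathcal X$. Then: (i) For every $(X_1,\dots,X_n)\in\mathcal X$ there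 is $(\bar X_1,\dots,\bar X_n)\in\mathcal X\cap\mathbb A_n^+(S)$ with $\bar X_i\le_{\mathrm{cx}}X_i$ for every $i$. (ii) Let $\rho_1,\dots,\rho_n:L^1\to\mathbb R\cup\{+\infty\}$ be convex-order consistent, i.e. $Y\le_{\mathrm{cx}}X$ implies $\rho_i(Y)\le\rho_i(X)$. Then, in $[-\infty,+\infty]$ (a sum with a term $+\infty$ being $+\infty$), $$\inf_{(X_1,\dots,X_n)\in\mathcal X}\ \sum_{i=1}^n\rho_i(X_i)\;=\;\inf_{(X_1,\dots,X_n)\in\mathcal X\cap\mathbb A_n^+(S)}\ \sum_{i=1}^n\rho_i(X_i).$$ (iii) Let $\rho_1,\dots,\rho_n$ be as in (ii), and let $(X_1^\star,\dots,X_n^\star)\in\mathcal X$ be Pareto optimal in $\mathcal X$, i.e. no $(Y_1,\dots,Y_n)\in\mathcal X$ satisfies $\rho_i(Y_i)\le\rho_i(X_i^\star)$ for every $i$ with at least one strict inequality. Then there is $(\bar X_1^\star,\dots,\bar X_n^\star)\in\mathcal X\cap\mathbb A_n^+(S)$ with $\rho_i(\bar X_i^\star)=\rho_i(X_i^\star)$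 for every $i$. -/

import Mathlib

open MeasureTheory

namespace RiskSharing

noncomputable section

variable {Ω : Type*} [MeasurableSpace Ω]

/-- A measure is atomless if every measurable set of positive measure contains a measurable
subset of strictly smaller positive measure. (Mathlib's `NoAtoms` only speaks of singletons.) -/
def Atomless (μ : Measure Ω) : Prop :=
  ∀ A : Set Ω, MeasurableSet A → 0 < μ A →
    ∃ B : Set Ω, MeasurableSet B ∧ B ⊆ A ∧ 0 < μ B ∧ μ B < μ A

/-- The extended expectation `E[f⁺] - E[f⁻]`. It is used only for `f = φ(X)` with `φ` convex and
`X` in `L¹` of a probability measure; there `E[f⁻]` is finite, because `φ` has an affine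
minorant, so the value is a real number or `+∞`. -/
def extExpectation (μ : Measure Ω) (f : Ω → ℝ) : EReal :=
  ((∫⁻ ω, ENNReal.ofReal (f ω) ∂μ : ENNReal) : EReal) -
    ((∫⁻ ω, ENNReal.ofReal (-f ω) ∂μ : ENNReal) : EReal)

/-- The convex order `Y ≤_cx X` on `L¹`. -/
def ConvexOrder {μ : Measure Ω} (Y X : Lp ℝ 1 μ) : Prop :=
  ∫ ω, Y ω ∂μ = ∫ ω, X ω ∂μ ∧
    ∀ φ : ℝ → ℝ, ConvexOn ℝ Set.univ φ →
      extExpectation μ (fun ω => φ (Y ω)) ≤ extExpectation μ (fun ω => φ (X ω))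

/-- The clearing allocations `𝔸ₙ(S)`. -/
def clearingAllocations {μ : Measure Ω} (n : ℕ) (S : Lp ℝ 1 μ) : Set (Fin n → Lp ℝ 1 μ) :=
  {X | ∀ᵐ ω ∂μ, ∑ i, X i ω = S ω}

/-- The comonotonic clearing allocations `𝔸ₙ⁺(S)`. -/
def comonotonicAllocations {μ : Measure Ω} (n : ℕ) (S : Lp ℝ 1 μ) : Set (Fin n → Lp ℝ 1 μ) :=
  {X | X ∈ clearingAllocations n S ∧
    ∃ f : Fin n → ℝ → ℝ, (∀ i, Monotone (f i)) ∧ ∀ i, ∀ᵐ ω ∂μ, X i ω = f i (S ω)}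

/-- `𝒳 ⊆ 𝔸ₙ(S)` is componentwise convex-order solid. -/
def ConvexOrderSolid {μ : Measure Ω} {n : ℕ} (S : Lp ℝ 1 μ)
    (𝒳 : Set (Fin n → Lp ℝ 1 μ)) : Prop :=
  ∀ X ∈ 𝒳, ∀ Y ∈ clearingAllocations n S, (∀ i, ConvexOrder (Y i) (X i)) → Y ∈ 𝒳

/-- A convex-order-consistent risk measure `ρ : L¹ → ℝ ∪ {+∞}`. -/
structure ConvexOrderConsistent {μ : Measure Ω} (ρ : Lp ℝ 1 μ → EReal) : Prop where
  ne_bot : ∀ X, ρ X ≠ ⊥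
  mono : ∀ Y X, ConvexOrder Y X → ρ Y ≤ ρ X

/-- `X` is Pareto optimal in `𝒳` for the risk measures `ρ i`. -/
def ParetoOptimal {μ : Measure Ω} {n : ℕ} (ρ : Fin n → Lp ℝ 1 μ → EReal)
    (𝒳 : Set (Fin n → Lp ℝ 1 μ)) (X : Fin n → Lp ℝ 1 μ) : Prop :=
  X ∈ 𝒳 ∧ ¬ ∃ Y ∈ 𝒳, (∀ i, ρ i (Y i) ≤ ρ i (X i)) ∧ ∃ i, ρ i (Y i) < ρ i (X i)

end

end RiskSharing

namespace RiskSharing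

open Filter Topology

/-! Parts (ii) and (iii) follow formally from (i), and solidity reduces (i) to improving a clearing
allocation `X` by one of the form `F (S)`, with `F` a monotone split.

A positive combination of convex costs, perturbed to be strictly convex and coercive, can be
minimized pointwise over all ways of splitting `s`. By an exchange argument the minimizer is
monotone in `s` (`exists_isMonotoneSplit_minimizer`), so `F (S)` beats `X` for one weighted sum of
costs, up to a small error. Monotone splits form a convex set, so Hahn–Banach turns "some `F` for
each choice of weights" into "one `F` for finitely many test functions, up to `ε`"
(`exists_isMonotoneSplit_finite`). Monotone splits bounded at `0` are compact by Arzelà–Ascoli, and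
the finite intersection property gives one `F` for all test functions
(`exists_isMonotoneSplit_forall`). Approximation then passes from test functions to the full convex
order (`extExpectation_comp_le_of_test`). -/

/-- A coordinatewise nondecreasing map that splits every real number into a sum. -/
structure IsMonotoneSplit {ι : Type*} [Fintype ι] (F : ℝ → ι → ℝ) : Prop where
  mono : Monotone F
  sum_eq : ∀ s, ∑ i, F s i = s

/-- A nonnegative convex Lipschitz function. -/
structure IsTestFunction (φ : ℝ → ℝ) : Prop where
  convex : ConvexOn ℝ Set.univ φ
  lipschitz : ∃ K, LipschitzWith K φ
  nonneg : ∀ x, 0 ≤ φ x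

/-! ### Monotone splits: compactness, and existence by pointwise minimization. -/

section MonotoneSplit

variable {ι : Type*} [Fintype ι]

/-- The coordinate increments are nonnegative and add up to `t - s`, so none exceeds `t - s`. -/
theorem IsMonotoneSplit.lipschitz {F : ℝ → ι → ℝ} (hF : IsMonotoneSplit F) :
    LipschitzWith 1 F := by
  have key : ∀ s t, s ≤ t → ∀ i, |F t i - F s i| ≤ |t - s| := by
    intro s t hst i
    rw [abs_of_nonneg (sub_nonneg.2 (hF.mono hst i)), abs_of_nonneg (sub_nonneg.2 hst)]
    have h := Finset.single_le_sum (f := fun i => F t i - F s i)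
      (fun i _ => sub_nonneg.2 (hF.mono hst i)) (Finset.mem_univ i)
    rwa [Finset.sum_sub_distrib, hF.sum_eq, hF.sum_eq] at h
  refine LipschitzWith.of_dist_le_mul fun s t => ?_
  rw [NNReal.coe_one, one_mul, dist_pi_le_iff dist_nonneg]
  intro i
  rw [Real.dist_eq, Real.dist_eq]
  rcases le_total s t with h | h
  · rw [abs_sub_comm, abs_sub_comm s]; exact key s t h i
  · exact key t s h i

theorem IsMonotoneSplit.abs_le {F : ℝ → ι → ℝ} (hF : IsMonotoneSplit F) (s : ℝ) (i : ι) :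
    |F s i| ≤ |F 0 i| + |s| := by
  have h := (dist_le_pi_dist (F s) (F 0) i).trans (hF.lipschitz.dist_le_mul s 0)
  rw [Real.dist_eq, Real.dist_eq, sub_zero, NNReal.coe_one, one_mul] at h
  linarith [abs_sub_abs_le_abs_sub (F s i) (F 0 i)]

theorem IsMonotoneSplit.abs_zero_le {F : ℝ → ι → ℝ} (hF : IsMonotoneSplit F) (s : ℝ) (i : ι) :
    |F 0 i| ≤ |F s i| + |s| := by
  have h := (dist_le_pi_dist (F 0) (F s) i).trans (hF.lipschitz.dist_le_mul 0 s)
  rw [Real.dist_eq, Real.dist_eq, zero_sub, abs_neg, NNReal.coe_one, one_mul] at h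
  linarith [abs_sub_abs_le_abs_sub (F 0 i) (F s i)]

theorem IsMonotoneSplit.convexComb {F G : ℝ → ι → ℝ} (hF : IsMonotoneSplit F)
    (hG : IsMonotoneSplit G) {a b : ℝ} (ha : 0 ≤ a) (hb : 0 ≤ b) (hab : a + b = 1) :
    IsMonotoneSplit (fun s i => a * F s i + b * G s i) where
  mono s t hst i := add_le_add (mul_le_mul_of_nonneg_left (hF.mono hst i) ha)
    (mul_le_mul_of_nonneg_left (hG.mono hst i) hb)
  sum_eq s := by
    rw [Finset.sum_add_distrib, ← Finset.mul_sum, ← Finset.mul_sum, hF.sum_eq, hG.sum_eq,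
      ← add_mul, hab, one_mul]

theorem isCompact_monotoneSplit (R : ℝ) :
    IsCompact {F : C(ℝ, ι → ℝ) | IsMonotoneSplit F ∧ ∀ i, |F 0 i| ≤ R} := by
  apply ArzelaAscoli.isCompact_of_equicontinuous
  · have himage : ContinuousMap.toFun '' {F : C(ℝ, ι → ℝ) | IsMonotoneSplit F ∧ ∀ i, |F 0 i| ≤ R}
        = {g : ℝ → ι → ℝ | IsMonotoneSplit g ∧ ∀ i, |g 0 i| ≤ R} := by
      ext g
      constructor
      · rintro ⟨F, hF, rfl⟩; exact hF
      · intro hg; exact ⟨⟨g, hg.1.lipschitz.continuous⟩, hg, rfl⟩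
    rw [himage]
    -- In the product topology the set is closed and, by `abs_le`, lies in a product of compact
    -- intervals.
    refine IsCompact.of_isClosed_subset
      (isCompact_univ_pi fun s => isCompact_univ_pi fun _ : ι => isCompact_Icc
        (a := -(R + |s|)) (b := R + |s|)) ?_ ?_
    · have : {g : ℝ → ι → ℝ | IsMonotoneSplit g ∧ ∀ i, |g 0 i| ≤ R} =
          {g : ℝ → ι → ℝ | Monotone g} ∩ ((⋂ s, {g : ℝ → ι → ℝ | ∑ i, g s i = s}) ∩
            ⋂ i, {g : ℝ → ι → ℝ | |g 0 i| ≤ R}) := by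
        ext g
        simp only [Set.mem_ofPred_eq, Set.mem_inter_iff, Set.mem_iInter]
        exact ⟨fun h => ⟨h.1.1, h.1.2, h.2⟩, fun h => ⟨⟨h.1, h.2.1⟩, h.2.2⟩⟩
      rw [this]
      refine isClosed_monotone.inter ((isClosed_iInter fun s => ?_).inter
        (isClosed_iInter fun i => ?_))
      · exact isClosed_eq (by fun_prop) continuous_const
      · exact isClosed_le (by fun_prop) continuous_const
    · intro g hg s _ i _
      exact _root_.abs_le.1 ((hg.1.abs_le s i).trans (by linarith [hg.2 i]))
  · exact (LipschitzWith.uniformEquicontinuous _ 1 fun F => F.2.1.lipschitz).equicontinuous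

/-- Both new points are convex combinations of `p` and `q`, with the two weights interchanged. This
drives the exchange argument. -/
theorem add_lt_add_of_strictConvexOn {ψ : ℝ → ℝ} (hψ : StrictConvexOn ℝ Set.univ ψ)
    {p q η : ℝ} (hη : 0 < η) (hpq : η < q - p) : ψ (p + η) + ψ (q - η) < ψ p + ψ q := by
  have hd : 0 < q - p := hη.trans hpq
  have ht0 : 0 < η / (q - p) := div_pos hη hd
  have ht1 : 0 < 1 - η / (q - p) := by rw [sub_pos, div_lt_one hd]; exact hpq
  have hm : η / (q - p) * (q - p) = η := div_mul_cancel₀ _ hd.ne'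
  have hne : p ≠ q := by rintro rfl; simp at hd
  have h1 := hψ.2 (Set.mem_univ p) (Set.mem_univ q) hne ht1 ht0 (by ring)
  have h2 := hψ.2 (Set.mem_univ p) (Set.mem_univ q) hne ht0 ht1 (by ring)
  simp only [smul_eq_mul] at h1 h2
  have e1 : (1 - η / (q - p)) * p + η / (q - p) * q = p + η := by linear_combination hm
  have e2 : η / (q - p) * p + (1 - η / (q - p)) * q = q - η := by linear_combination -hm
  rw [e1] at h1
  rw [e2] at h2
  linarith

/-- Transferring `η` from coordinate `i` to coordinate `k`. -/
theorem sum_transfer [DecidableEq ι] (ψ : ι → ℝ → ℝ) (x : ι → ℝ) {i k : ι} (hik : i ≠ k)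
    (u v : ℝ) :
    ∑ j, ψ j (Function.update (Function.update x i u) k v j) =
      ∑ j, ψ j (x j) + (ψ i u - ψ i (x i)) + (ψ k v - ψ k (x k)) := by
  have h : ∀ j, ψ j (Function.update (Function.update x i u) k v j) =
      ψ j (x j) + (if j = i then ψ i u - ψ i (x i) else 0)
        + (if j = k then ψ k v - ψ k (x k) else 0) := by
    intro j
    by_cases hk : j = k
    · subst hk; simp [hik.symm]
    · by_cases hi : j = i
      · subst hi; simp [hik]
      · simp [hk, hi]
  simp [h, Finset.sum_add_distrib]

/-- Pointwise minimizers of a sum of strictly convex coercive costs form a monotone split. -/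
theorem exists_isMonotoneSplit_minimizer [Nonempty ι] {ψ : ι → ℝ → ℝ} {δ : ℝ} (hδ : 0 < δ)
    (hconv : ∀ i, StrictConvexOn ℝ Set.univ (ψ i)) (hcont : ∀ i, Continuous (ψ i))
    (hcoer : ∀ i x, δ * |x| ≤ ψ i x) :
    ∃ F : ℝ → ι → ℝ, IsMonotoneSplit F ∧
      ∀ x : ι → ℝ, ∑ i, ψ i (F (∑ i, x i) i) ≤ ∑ i, ψ i (x i) := by
  classical
  have hex : ∀ s : ℝ, ∃ x : ι → ℝ, ∑ i, x i = s ∧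
      ∀ y : ι → ℝ, ∑ i, y i = s → ∑ i, ψ i (x i) ≤ ∑ i, ψ i (y i) := by
    intro s
    let f : (ι → ℝ) → ℝ := fun x => ∑ i, ψ i (x i)
    have hf : Continuous f := by fun_prop
    have hbound : ∀ x, δ * ‖x‖ ≤ f x := by
      intro x
      have h1 : ‖x‖ ≤ ∑ i, |x i| := (pi_norm_le_iff_of_nonneg
        (Finset.sum_nonneg fun i _ => abs_nonneg _)).2 fun i =>
          Finset.single_le_sum (f := fun i => |x i|) (fun i _ => abs_nonneg _) (Finset.mem_univ i)
      calc δ * ‖x‖ ≤ δ * ∑ i, |x i| := mul_le_mul_of_nonneg_left h1 hδ.le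
        _ = ∑ i, δ * |x i| := Finset.mul_sum _ _ _
        _ ≤ f x := Finset.sum_le_sum fun i _ => hcoer i _
    have htend : Tendsto f (cocompact (ι → ℝ)) atTop :=
      tendsto_atTop_mono hbound ((tendsto_norm_cocompact_atTop).const_mul_atTop hδ)
    obtain ⟨i₀⟩ := ‹Nonempty ι›
    have hx₀ : Pi.single i₀ s ∈ {x : ι → ℝ | ∑ i, x i = s} := by simp
    obtain ⟨x, hx, hmin⟩ := hf.continuousOn.exists_isMinOn'
      (isClosed_eq (by fun_prop) continuous_const) hx₀
      ((htend.eventually_ge_atTop _).filter_mono inf_le_left)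
    exact ⟨x, hx, fun y hy => hmin hy⟩
  choose F hFsum hFmin using hex
  refine ⟨F, ⟨fun s t hst i => ?_, hFsum⟩, fun x => hFmin _ x rfl⟩
  by_contra! hlt
  obtain ⟨k, hk⟩ : ∃ k, F s k < F t k := by
    by_contra! hge
    have := Finset.sum_lt_sum (fun j _ => hge j) ⟨i, Finset.mem_univ i, hlt⟩
    rw [hFsum, hFsum] at this
    exact absurd hst (not_le.2 this)
  have hik : i ≠ k := by rintro rfl; exact lt_asymm hlt hk
  obtain ⟨η, hη, hη'⟩ : ∃ η > 0, η < min (F s i - F t i) (F t k - F s k) :=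
    exists_between (lt_min (sub_pos.2 hlt) (sub_pos.2 hk))
  have hηi := hη'.trans_le (min_le_left _ _)
  have hηk := hη'.trans_le (min_le_right _ _)
  -- If coordinate `i` drops from `s` to `t` while `k` rises, moving `η` from `i` to `k` at `s` and
  -- back at `t` keeps both totals and strictly lowers the combined cost, against minimality.
  have h1 := hFmin s (Function.update (Function.update (F s) i (F s i - η)) k (F s k + η)) (by
    have := sum_transfer (fun _ x => x) (F s) hik (F s i - η) (F s k + η)
    rw [this, hFsum]; ring)
  have h2 := hFmin t (Function.update (Function.update (F t) i (F t i + η)) k (F t k - η)) (by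
    have := sum_transfer (fun _ x => x) (F t) hik (F t i + η) (F t k - η)
    rw [this, hFsum]; ring)
  rw [sum_transfer ψ _ hik] at h1 h2
  have h3 := add_lt_add_of_strictConvexOn (hconv i) hη hηi
  have h4 := add_lt_add_of_strictConvexOn (hconv k) hη hηk
  linarith

end MonotoneSplit

/-- After squaring, this is the strict Cauchy–Schwarz inequality for `(1, x)` and `(1, y)`. The
function lies between `|x|` and `1 + |x|`, so it supplies strict convexity and coercivity while
staying integrable. -/
theorem strictConvexOn_sqrt_one_add_sq :
    StrictConvexOn ℝ Set.univ fun x : ℝ => √(1 + x ^ 2) := by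
  refine ⟨convex_univ, fun x _ y _ hxy a b ha hb hab => ?_⟩
  simp only [smul_eq_mul]
  have hx := Real.sq_sqrt (by positivity : 0 ≤ 1 + x ^ 2)
  have hy := Real.sq_sqrt (by positivity : 0 ≤ 1 + y ^ 2)
  have hcross : 1 + x * y < √(1 + x ^ 2) * √(1 + y ^ 2) := by
    rw [← Real.sqrt_mul (by positivity)]
    apply Real.lt_sqrt_of_sq_lt
    have : 0 < (x - y) ^ 2 := by have := sub_ne_zero.2 hxy; positivity
    linarith
  rw [Real.sqrt_lt' (by positivity)]
  have hb' : b = 1 - a := by linarith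
  have h2 : 0 < 2 * (a * b) := by positivity
  have := mul_lt_mul_of_pos_left hcross h2
  calc 1 + (a * x + b * y) ^ 2
      = a ^ 2 * (1 + x ^ 2) + b ^ 2 * (1 + y ^ 2) + 2 * (a * b) * (1 + x * y) := by
        rw [hb']; ring
    _ < a ^ 2 * (1 + x ^ 2) + b ^ 2 * (1 + y ^ 2)
          + 2 * (a * b) * (√(1 + x ^ 2) * √(1 + y ^ 2)) := by linarith
    _ = (a * √(1 + x ^ 2) + b * √(1 + y ^ 2)) ^ 2 := by
        linear_combination -a ^ 2 * hx - b ^ 2 * hy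

theorem abs_le_sqrt_one_add_sq (x : ℝ) : |x| ≤ √(1 + x ^ 2) :=
  Real.abs_le_sqrt (by linarith)

theorem sqrt_one_add_sq_le (x : ℝ) : √(1 + x ^ 2) ≤ 1 + |x| := by
  rw [Real.sqrt_le_left (by positivity)]
  nlinarith [sq_abs x, abs_nonneg x]

/-! ### Simultaneous domination of test functions: separation and compactness. -/

section Integration

variable {Ω : Type*} [MeasurableSpace Ω] {μ : Measure Ω} [IsFiniteMeasure μ]

theorem integrable_comp_lipschitz {φ : ℝ → ℝ} {K : NNReal} (hφ : LipschitzWith K φ)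
    {Y : Ω → ℝ} (hY : Integrable Y μ) : Integrable (fun ω => φ (Y ω)) μ := by
  refine Integrable.mono' ((integrable_const |φ 0|).add (hY.abs.const_mul (K : ℝ)))
    (hφ.continuous.comp_aestronglyMeasurable hY.1) (Eventually.of_forall fun ω => ?_)
  have h := hφ.dist_le_mul (Y ω) 0
  rw [Real.dist_eq, Real.dist_eq, sub_zero] at h
  simp only [Real.norm_eq_abs, Pi.add_apply]
  linarith [abs_sub_abs_le_abs_sub (φ (Y ω)) (φ 0)]

theorem IsTestFunction.integrable_comp {φ : ℝ → ℝ} (hφ : IsTestFunction φ)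
    {Y : Ω → ℝ} (hY : Integrable Y μ) : Integrable (fun ω => φ (Y ω)) μ :=
  integrable_comp_lipschitz hφ.lipschitz.choose_spec hY

theorem IsTestFunction.abs : IsTestFunction (fun x : ℝ => |x|) where
  convex := convexOn_univ_norm (E := ℝ)
  lipschitz := ⟨1, lipschitzWith_one_norm (E := ℝ)⟩
  nonneg := abs_nonneg

variable {ι : Type*} [Fintype ι]

theorem IsMonotoneSplit.integrable_comp {F : ℝ → ι → ℝ} (hF : IsMonotoneSplit F)
    {S : Ω → ℝ} (hS : Integrable S μ) (i : ι) : Integrable (fun ω => F (S ω) i) μ := by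
  have hl : LipschitzWith 1 fun s => F s i := LipschitzWith.of_dist_le_mul fun s t =>
    (dist_le_pi_dist _ _ i).trans (hF.lipschitz.dist_le_mul s t)
  exact integrable_comp_lipschitz hl hS

/-- The integral inequality satisfied by the minimizers of a positive combination of costs. -/
theorem exists_isMonotoneSplit_weighted [Nonempty ι] {J : Type*} [Fintype J] {X : ι → Ω → ℝ}
    (hX : ∀ i, Integrable (X i) μ) {S : Ω → ℝ} (hS : Integrable S μ)
    (hXS : ∀ᵐ ω ∂μ, ∑ i, X i ω = S ω) (a : J → ι) {φ : J → ℝ → ℝ}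
    (hφ : ∀ j, IsTestFunction (φ j)) {w : J → ℝ} (hw : ∀ j, 0 ≤ w j) {δ : ℝ} (hδ : 0 < δ) :
    ∃ F : ℝ → ι → ℝ, IsMonotoneSplit F ∧
      ∑ j, w j * ∫ ω, φ j (F (S ω) (a j)) ∂μ ≤
        ∑ j, w j * ∫ ω, φ j (X (a j) ω) ∂μ + δ * ∑ i, ∫ ω, (1 + |X i ω|) ∂μ := by
  classical
  -- `θ i` collects the weighted test functions attached to coordinate `i`; the `δ` term in `ψ`
  -- makes the minimization well posed.
  let θ : ι → ℝ → ℝ := fun i x => ∑ j, if a j = i then w j * φ j x else 0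
  let ψ : ι → ℝ → ℝ := fun i x => θ i x + δ * √(1 + x ^ 2)
  have hθ0 : ∀ i x, 0 ≤ θ i x := fun i x => Finset.sum_nonneg fun j _ => by
    split_ifs
    · exact mul_nonneg (hw j) ((hφ j).nonneg x)
    · exact le_rfl
  have hθconv : ∀ i, ConvexOn ℝ Set.univ (θ i) := by
    intro i
    refine ⟨convex_univ, fun x _ y _ p q hp hq hpq => ?_⟩
    simp only [θ, smul_eq_mul, Finset.mul_sum, ← Finset.sum_add_distrib]
    refine Finset.sum_le_sum fun j _ => ?_
    split_ifs
    · have := mul_le_mul_of_nonneg_left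
        ((hφ j).convex.2 (Set.mem_univ x) (Set.mem_univ y) hp hq hpq) (hw j)
      simp only [smul_eq_mul] at this
      linarith
    · simp
  have hsqrt : StrictConvexOn ℝ Set.univ fun x : ℝ => δ * √(1 + x ^ 2) := by
    refine ⟨convex_univ, fun x hx y hy hxy p q hp hq hpq => ?_⟩
    have := mul_lt_mul_of_pos_left (strictConvexOn_sqrt_one_add_sq.2 hx hy hxy hp hq hpq) hδ
    simp only [smul_eq_mul] at this ⊢
    linarith
  have hθcont : ∀ i, Continuous (θ i) := by
    intro i
    refine continuous_finsetSum _ fun j _ => ?_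
    split_ifs
    · exact continuous_const.mul (hφ j).lipschitz.choose_spec.continuous
    · exact continuous_const
  have hθsum : ∀ x : ι → ℝ, ∑ i, θ i (x i) = ∑ j, w j * φ j (x (a j)) := by
    intro x
    simp only [θ]
    rw [Finset.sum_comm]
    exact Finset.sum_congr rfl fun j _ => by simp
  obtain ⟨F, hF, hmin⟩ := exists_isMonotoneSplit_minimizer (ψ := ψ) hδ
    (fun i => (hθconv i).add_strictConvexOn hsqrt)
    (fun i => (hθcont i).add (by fun_prop))
    (fun i x => by
      have := mul_le_mul_of_nonneg_left (abs_le_sqrt_one_add_sq x) hδ.le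
      simp only [ψ]
      linarith [hθ0 i x])
  refine ⟨F, hF, ?_⟩
  have hi1 : ∀ j ∈ Finset.univ, Integrable (fun ω => w j * φ j (F (S ω) (a j))) μ := fun j _ =>
    ((hφ j).integrable_comp (hF.integrable_comp hS (a j))).const_mul _
  have hi2 : ∀ j ∈ Finset.univ, Integrable (fun ω => w j * φ j (X (a j) ω)) μ := fun j _ =>
    ((hφ j).integrable_comp (hX (a j))).const_mul _
  have hi3 : ∀ i ∈ Finset.univ, Integrable (fun ω => 1 + |X i ω|) μ := fun i _ =>
    (integrable_const _).add (hX i).abs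
  have hpt : ∀ᵐ ω ∂μ, ∑ j, w j * φ j (F (S ω) (a j)) ≤
      ∑ j, w j * φ j (X (a j) ω) + δ * ∑ i, (1 + |X i ω|) := by
    filter_upwards [hXS] with ω hω
    have h := hmin fun i => X i ω
    simp only [ψ, hω, Finset.sum_add_distrib, hθsum] at h
    have h1 : 0 ≤ ∑ i, δ * √(1 + F (S ω) i ^ 2) :=
      Finset.sum_nonneg fun i _ => by positivity
    have h2 : ∑ i, δ * √(1 + X i ω ^ 2) ≤ δ * ∑ i, (1 + |X i ω|) := by
      rw [Finset.mul_sum]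
      exact Finset.sum_le_sum fun i _ => mul_le_mul_of_nonneg_left (sqrt_one_add_sq_le _) hδ.le
    linarith
  have := integral_mono_ae (integrable_finsetSum _ hi1)
    ((integrable_finsetSum _ hi2).add ((integrable_finsetSum _ hi3).const_mul δ)) hpt
  simp only [Pi.add_apply] at this
  rw [integral_add (integrable_finsetSum _ hi2) ((integrable_finsetSum _ hi3).const_mul δ),
    integral_const_mul, integral_finsetSum _ hi1, integral_finsetSum _ hi2,
    integral_finsetSum _ hi3] at this
  simpa only [integral_const_mul] using this

/-- Otherwise a hyperplane separates the orthant below `ε` from the convex set of vectors dominating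
an attainable vector of integral differences. Its normal is a nonnegative weight vector, for which
`exists_isMonotoneSplit_weighted` gives a contradiction. -/
theorem exists_isMonotoneSplit_finite [Nonempty ι] {J : Type*} [Fintype J] {X : ι → Ω → ℝ}
    (hX : ∀ i, Integrable (X i) μ) {S : Ω → ℝ} (hS : Integrable S μ)
    (hXS : ∀ᵐ ω ∂μ, ∑ i, X i ω = S ω) (a : J → ι) {φ : J → ℝ → ℝ}
    (hφ : ∀ j, IsTestFunction (φ j)) {ε : J → ℝ} (hε : ∀ j, 0 < ε j) :
    ∃ F : ℝ → ι → ℝ, IsMonotoneSplit F ∧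
      ∀ j, ∫ ω, φ j (F (S ω) (a j)) ∂μ ≤ ∫ ω, φ j (X (a j) ω) ∂μ + ε j := by
  classical
  by_contra! hno
  let B : Set (J → ℝ) := Set.univ.pi fun j => Set.Iio (ε j)
  let A : Set (J → ℝ) := {y | ∃ F : ℝ → ι → ℝ, IsMonotoneSplit F ∧
      ∀ j, ∫ ω, φ j (F (S ω) (a j)) ∂μ - ∫ ω, φ j (X (a j) ω) ∂μ ≤ y j}
  have hB : Convex ℝ B := convex_pi fun j _ => convex_Iio _
  have hBo : IsOpen B := isOpen_set_pi Set.finite_univ fun j _ => isOpen_Iio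
  have hA : Convex ℝ A := by
    rintro y ⟨F, hF, hFy⟩ z ⟨G, hG, hGz⟩ p q hp hq hpq
    refine ⟨_, hF.convexComb hG hp hq hpq, fun j => ?_⟩
    have hFi := (hφ j).integrable_comp (hF.integrable_comp hS (a j))
    have hGi := (hφ j).integrable_comp (hG.integrable_comp hS (a j))
    have h1 : ∫ ω, φ j (p * F (S ω) (a j) + q * G (S ω) (a j)) ∂μ ≤
        ∫ ω, (p * φ j (F (S ω) (a j)) + q * φ j (G (S ω) (a j))) ∂μ :=
      integral_mono
        ((hφ j).integrable_comp ((hF.convexComb hG hp hq hpq).integrable_comp hS (a j)))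
        ((hFi.const_mul p).add (hGi.const_mul q))
        fun ω => (hφ j).convex.2 (Set.mem_univ _) (Set.mem_univ _) hp hq hpq
    rw [integral_add (hFi.const_mul p) (hGi.const_mul q), integral_const_mul,
      integral_const_mul] at h1
    have h2 := mul_le_mul_of_nonneg_left (hFy j) hp
    have h3 := mul_le_mul_of_nonneg_left (hGz j) hq
    simp only [Pi.add_apply, Pi.smul_apply, smul_eq_mul]
    have h4 : (p + q) * ∫ ω, φ j (X (a j) ω) ∂μ = ∫ ω, φ j (X (a j) ω) ∂μ := by
      rw [hpq, one_mul]
    linarith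
  have hdisj : Disjoint B A := by
    rw [Set.disjoint_left]
    rintro y hyB ⟨F, hF, hFy⟩
    obtain ⟨j, hj⟩ := hno F hF
    have := hyB j (Set.mem_univ j)
    rw [Set.mem_Iio] at this
    linarith [hFy j]
  obtain ⟨f, u, hfB, hfA⟩ := geometric_hahn_banach_open hB hBo hA hdisj
  -- The origin lies in `B` because every `ε j` is positive.
  have hu : 0 < u := by
    simpa using hfB 0 fun j _ => hε j
  let w : J → ℝ := fun j => f (Pi.single j 1)
  have hf : ∀ y, f y = ∑ j, w j * y j := by
    intro y
    have := LinearMap.pi_apply_eq_sum_univ f.toLinearMap y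
    simp only [ContinuousLinearMap.coe_coe, smul_eq_mul] at this
    rw [this]
    refine Finset.sum_congr rfl fun j _ => ?_
    rw [mul_comm]
    congr 2
    ext k
    simp [Pi.single_apply, eq_comm]
  have hw : ∀ j, 0 ≤ w j := by
    intro j
    by_contra! hj
    -- If `w j < 0`, this point lies in `B`, yet `f` takes the value `u` there.
    have h := hfB (Pi.single j (u / w j)) fun k _ => by
      rw [Set.mem_Iio]
      by_cases hk : k = j
      · subst hk
        rw [Pi.single_eq_same]
        exact (div_neg_of_pos_of_neg hu hj).trans (hε k)
      · rw [Pi.single_eq_of_ne hk]; exact hε k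
    rw [hf] at h
    simp only [Pi.single_apply, mul_ite, mul_zero, Finset.sum_ite_eq', Finset.mem_univ,
      if_true] at h
    rw [mul_div_cancel₀ _ hj.ne] at h
    exact lt_irrefl _ h
  let M := ∑ i, ∫ ω, (1 + |X i ω|) ∂μ
  have hM : 0 ≤ M := Finset.sum_nonneg fun i _ => integral_nonneg fun ω => by positivity
  -- With this `δ` the error `δ * M` stays below `u`.
  obtain ⟨F, hF, hle⟩ := exists_isMonotoneSplit_weighted hX hS hXS a hφ hw
    (δ := u / (M + 1) / 2) (by positivity)
  have h := hfA _ ⟨F, hF, fun j => le_rfl⟩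
  rw [hf] at h
  simp only [mul_sub, Finset.sum_sub_distrib] at h
  have h1 : u / (M + 1) / 2 * M < u := by
    rw [div_div, div_mul_eq_mul_div, div_lt_iff₀ (by positivity)]
    nlinarith
  change _ ≤ _ + u / (M + 1) / 2 * M at hle
  linarith

/-- Some comonotonic allocation is dominated for all test functions at once. -/
theorem exists_isMonotoneSplit_forall [Nonempty ι] [IsProbabilityMeasure μ] {X : ι → Ω → ℝ}
    (hX : ∀ i, Integrable (X i) μ) {S : Ω → ℝ} (hS : Integrable S μ)
    (hXS : ∀ᵐ ω ∂μ, ∑ i, X i ω = S ω) :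
    ∃ F : ℝ → ι → ℝ, IsMonotoneSplit F ∧ ∀ i φ, IsTestFunction φ →
      ∫ ω, φ (F (S ω) i) ∂μ ≤ ∫ ω, φ (X i ω) ∂μ := by
  classical
  -- Domination of `|x|` up to `1`, together with `|F 0 i| ≤ |F s i| + |s|`, forces `|F 0 i| ≤ R`.
  let R : ℝ := ∑ i, ∫ ω, |X i ω| ∂μ + 1 + ∫ ω, |S ω| ∂μ
  let K : Set C(ℝ, ι → ℝ) := {F | IsMonotoneSplit F ∧ ∀ i, |F 0 i| ≤ R}
  have hK : CompactSpace K := isCompact_iff_compactSpace.1 (isCompact_monotoneSplit R)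
  let T := ι × {φ : ℝ → ℝ // IsTestFunction φ} × {ε : ℝ // 0 < ε}
  let Z : T → Set K := fun t => {F | ∫ ω, t.2.1.1 (F.1 (S ω) t.1) ∂μ ≤
    ∫ ω, t.2.1.1 (X t.1 ω) ∂μ + t.2.2.1}
  have hZ : ∀ t, IsClosed (Z t) := by
    rintro ⟨i, ⟨φ, hφ⟩, ε, hε⟩
    refine isClosed_le ?_ continuous_const
    obtain ⟨L, hL⟩ := hφ.lipschitz
    refine continuous_of_dominated (bound := fun ω => |φ 0| + L * (R + |S ω|))
      (fun F => (hφ.integrable_comp (F.2.1.integrable_comp hS i)).1)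
      (fun F => Eventually.of_forall fun ω => ?_)
      ((integrable_const _).add (((integrable_const _).add hS.abs).const_mul _))
      (Eventually.of_forall fun ω => hL.continuous.comp ?_)
    · have h := hL.dist_le_mul (F.1 (S ω) i) 0
      rw [Real.dist_eq, Real.dist_eq, sub_zero] at h
      have h1 : |F.1 (S ω) i| ≤ R + |S ω| := (F.2.1.abs_le _ i).trans (by linarith [F.2.2 i])
      have h2 := mul_le_mul_of_nonneg_left h1 L.2
      simp only [Real.norm_eq_abs]
      have h3 := abs_sub_abs_le_abs_sub (φ (F.1 (S ω) i)) (φ 0)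
      change (L : ℝ) * _ ≤ L * _ at h2
      linarith
    · exact (continuous_apply i).comp ((continuous_eval_const (S ω)).comp
        continuous_subtype_val)
  have hfin : ∀ u : Finset T, (Set.univ ∩ ⋂ t ∈ u, Z t).Nonempty := by
    intro u
    -- The absolute values join the finite family, with tolerance `1`, to keep `F` inside `K`.
    obtain ⟨F, hF, hle⟩ := exists_isMonotoneSplit_finite (J := ι ⊕ u) hX hS hXS
      (Sum.elim id fun t => t.1.1) (φ := Sum.elim (fun _ x => |x|) fun t => t.1.2.1.1)
      (by rintro (i | t); exacts [IsTestFunction.abs, t.1.2.1.2])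
      (ε := Sum.elim (fun _ => 1) fun t => t.1.2.2.1)
      (by rintro (i | t); exacts [one_pos, t.1.2.2.2])
    refine ⟨⟨⟨F, hF.lipschitz.continuous⟩, hF, fun i => ?_⟩, Set.mem_univ _, ?_⟩
    · have h1 := hle (Sum.inl i)
      simp only [Sum.elim_inl, id] at h1
      have hFi := (hF.integrable_comp hS i).abs
      have h2 : |F 0 i| ≤ ∫ ω, (|F (S ω) i| + |S ω|) ∂μ := by
        have := integral_mono (μ := μ) (integrable_const |F 0 i|) (hFi.add hS.abs)
          fun ω => hF.abs_zero_le (S ω) i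
        simpa using this
      rw [integral_add hFi hS.abs] at h2
      have h3 : ∫ ω, |X i ω| ∂μ ≤ ∑ i, ∫ ω, |X i ω| ∂μ :=
        Finset.single_le_sum (f := fun i => ∫ ω, |X i ω| ∂μ)
          (fun i _ => integral_nonneg fun ω => abs_nonneg _) (Finset.mem_univ i)
      change |F 0 i| ≤ R
      simp only [R]
      linarith
    · simp only [Set.mem_iInter]
      intro t ht
      exact hle (Sum.inr ⟨t, ht⟩)
  obtain ⟨F, -, hFZ⟩ := isCompact_univ.inter_iInter_nonempty Z hZ hfin
  refine ⟨F.1, F.2.1, fun i φ hφ => le_of_forall_pos_le_add fun ε hε => ?_⟩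
  exact Set.mem_iInter.1 hFZ (i, ⟨φ, hφ⟩, ⟨ε, hε⟩)

end Integration

/-! ### From test functions to the convex order. -/

section ConvexOrder

variable {Ω : Type*} [MeasurableSpace Ω] {μ : Measure Ω} [IsFiniteMeasure μ]

/-- Linear functions are not bounded below, so they are truncated at `-m`, shifted by `m` to become
test functions, and recovered by dominated convergence. Taking `b = 1` and `b = -1` yields equal
means. -/
theorem integral_const_mul_le_of_test {X Y : Ω → ℝ} (hX : Integrable X μ) (hY : Integrable Y μ)
    (h : ∀ φ, IsTestFunction φ → ∫ ω, φ (Y ω) ∂μ ≤ ∫ ω, φ (X ω) ∂μ) (b : ℝ) :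
    ∫ ω, b * Y ω ∂μ ≤ ∫ ω, b * X ω ∂μ := by
  have hlim : ∀ {Z : Ω → ℝ}, Integrable Z μ →
      Tendsto (fun m : ℕ => ∫ ω, max (b * Z ω) (-m) ∂μ) atTop (𝓝 (∫ ω, b * Z ω ∂μ)) := by
    intro Z hZ
    refine tendsto_integral_of_dominated_convergence (fun ω => |b * Z ω|)
      (fun m => ((hZ.const_mul b).sup (integrable_const (-(m : ℝ)))).1) (hZ.const_mul b).abs
      (fun m => Eventually.of_forall fun ω => ?_) (Eventually.of_forall fun ω => ?_)
    · have hm : (0 : ℝ) ≤ m := m.cast_nonneg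
      rw [Real.norm_eq_abs, abs_le]
      exact ⟨(neg_abs_le _).trans (le_max_left _ _),
        max_le (le_abs_self _) (by linarith [abs_nonneg (b * Z ω)])⟩
    · refine tendsto_const_nhds.congr' ?_
      obtain ⟨N, hN⟩ := exists_nat_ge (-(b * Z ω))
      filter_upwards [eventually_ge_atTop N] with m hm
      have : (N : ℝ) ≤ m := by exact_mod_cast hm
      rw [max_eq_left]
      linarith
  refine le_of_tendsto_of_tendsto' (hlim hY) (hlim hX) fun m => ?_
  have hl : LipschitzWith ‖b‖₊ fun x : ℝ => b * x := lipschitzWith_smul b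
  have htest : IsTestFunction fun x => max (b * x) (-m) + m :=
    { convex := (((LinearMap.mul ℝ ℝ b).convexOn convex_univ).sup
          (convexOn_const _ convex_univ)).add_const _
      lipschitz := ⟨‖b‖₊, LipschitzWith.of_dist_le_mul fun x y => by
        rw [dist_add_right]; exact (hl.max_const (-(m : ℝ))).dist_le_mul x y⟩
      nonneg := fun x => by linarith [le_max_right (b * x) (-(m : ℝ))] }
  have := h _ htest
  have hi : ∀ {Z : Ω → ℝ}, Integrable Z μ → Integrable (fun ω => max (b * Z ω) (-(m : ℝ))) μ :=
    fun hZ => (hZ.const_mul b).sup (integrable_const _)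
  rw [integral_add (hi hY) (integrable_const _), integral_add (hi hX) (integrable_const _)] at this
  exact le_of_add_le_add_right this

theorem integral_eq_of_test {X Y : Ω → ℝ} (hX : Integrable X μ) (hY : Integrable Y μ)
    (h : ∀ φ, IsTestFunction φ → ∫ ω, φ (Y ω) ∂μ ≤ ∫ ω, φ (X ω) ∂μ) :
    ∫ ω, Y ω ∂μ = ∫ ω, X ω ∂μ := by
  have h1 := integral_const_mul_le_of_test hX hY h 1
  have h2 := integral_const_mul_le_of_test hX hY h (-1)
  rw [integral_const_mul, integral_const_mul] at h1 h2
  linarith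

/-- A nonnegative convex function is an increasing limit of test functions. -/
theorem exists_test_tendsto {g : ℝ → ℝ} (hg : ConvexOn ℝ Set.univ g) (hg0 : ∀ x, 0 ≤ g x) :
    ∃ G : ℕ → ℝ → ℝ, (∀ m, IsTestFunction (G m)) ∧ (∀ x, Monotone fun m => G m x) ∧
      ∀ x, Tendsto (fun m => G m x) atTop (𝓝 (g x)) := by
  have hgc : Continuous g := continuousOn_univ.1 (hg.continuousOn isOpen_univ)
  obtain ⟨l, c, hle, hsup⟩ := hg.real_univ_sSup_of_nat_affine_eq hgc.lowerSemicontinuous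
  have hle' : ∀ k x, l k x + c k ≤ g x := fun k x => hle k x
  -- Running maximum of `0` and the first `m` members of a countable affine family with supremum
  -- `g`.
  let G : ℕ → ℝ → ℝ := fun m => Nat.rec (fun _ => 0) (fun k f x => max (f x) (l k x + c k)) m
  have hsucc : ∀ m x, G (m + 1) x = max (G m x) (l m x + c m) := fun m x => rfl
  have hmono : ∀ x, Monotone fun m => G m x := fun x =>
    monotone_nat_of_le_succ fun m => by rw [hsucc]; exact le_max_left _ _
  have hGg : ∀ m x, G m x ≤ g x := by
    intro m x
    induction m with
    | zero => exact hg0 x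
    | succ m ih => rw [hsucc]; exact max_le ih (hle' m x)
  refine ⟨G, fun m => ?_, hmono, fun x => ?_⟩
  · induction m with
    | zero => exact ⟨convexOn_const _ convex_univ, ⟨0, LipschitzWith.const _⟩, fun _ => le_rfl⟩
    | succ m ih =>
      obtain ⟨L, hL⟩ := ih.lipschitz
      have hl : LipschitzWith ‖l m‖₊ fun x : ℝ => l m x + c m :=
        LipschitzWith.of_dist_le_mul fun x y => by
          rw [dist_add_right]; exact (l m).lipschitz.dist_le_mul x y
      exact ⟨ih.convex.sup (((l m).toLinearMap.convexOn convex_univ).add_const _),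
        ⟨_, hL.max hl⟩, fun x => (ih.nonneg x).trans (le_max_left _ _)⟩
  · refine tendsto_atTop_isLUB (hmono x) ⟨?_, fun b hb => ?_⟩
    · rintro _ ⟨m, rfl⟩; exact hGg m x
    · have hx : g x = ⨆ k, (l k x + c k) := by
        rw [← hsup, iSup_apply]; rfl
      rw [hx]
      refine ciSup_le fun k => le_trans ?_ (hb ⟨k + 1, rfl⟩)
      change _ ≤ G (k + 1) x
      rw [hsucc]; exact le_max_right _ _

theorem lintegral_comp_le_of_test {X Y : Ω → ℝ} (hX : Integrable X μ) (hY : Integrable Y μ)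
    (h : ∀ φ, IsTestFunction φ → ∫ ω, φ (Y ω) ∂μ ≤ ∫ ω, φ (X ω) ∂μ)
    {g : ℝ → ℝ} (hg : ConvexOn ℝ Set.univ g) (hg0 : ∀ x, 0 ≤ g x) :
    ∫⁻ ω, ENNReal.ofReal (g (Y ω)) ∂μ ≤ ∫⁻ ω, ENNReal.ofReal (g (X ω)) ∂μ := by
  obtain ⟨G, hG, hmono, hlim⟩ := exists_test_tendsto hg hg0
  have hconv : ∀ {Z : Ω → ℝ}, Integrable Z μ →
      Tendsto (fun m => ∫⁻ ω, ENNReal.ofReal (G m (Z ω)) ∂μ) atTop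
        (𝓝 (∫⁻ ω, ENNReal.ofReal (g (Z ω)) ∂μ)) := fun {Z} hZ =>
    lintegral_tendsto_of_tendsto_of_monotone
      (fun m => ((hG m).integrable_comp hZ).1.aemeasurable.ennreal_ofReal)
      (Eventually.of_forall fun ω _ _ hmn => ENNReal.ofReal_le_ofReal (hmono (Z ω) hmn))
      (Eventually.of_forall fun ω => (ENNReal.continuous_ofReal.tendsto _).comp (hlim (Z ω)))
  refine le_of_tendsto_of_tendsto' (hconv hY) (hconv hX) fun m => ?_
  rw [← ofReal_integral_eq_lintegral_ofReal ((hG m).integrable_comp hY)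
      (Eventually.of_forall fun ω => (hG m).nonneg _),
    ← ofReal_integral_eq_lintegral_ofReal ((hG m).integrable_comp hX)
      (Eventually.of_forall fun ω => (hG m).nonneg _)]
  exact ENNReal.ofReal_le_ofReal (h _ (hG m))

/-- Integrating `(g + k)⁺ + k⁻ = g + k⁺ + (g + k)⁻` avoids subtracting infinities: only `(g + k)⁺`
and `g` can have infinite integral, and they do so together. -/
theorem extExpectation_add {g k : Ω → ℝ} (hg : AEMeasurable g μ) (hg0 : ∀ ω, 0 ≤ g ω)
    (hk : Integrable k μ) :
    extExpectation μ (fun ω => g ω + k ω) =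
      ((∫⁻ ω, ENNReal.ofReal (g ω) ∂μ : ENNReal) : EReal) + ((∫ ω, k ω ∂μ : ℝ) : EReal) := by
  have hkp : ∫⁻ ω, ENNReal.ofReal (k ω) ∂μ ≠ ⊤ := hk.lintegral_lt_top.ne
  have hkn : ∫⁻ ω, ENNReal.ofReal (-k ω) ∂μ ≠ ⊤ := hk.neg.lintegral_lt_top.ne
  have hn : ∫⁻ ω, ENNReal.ofReal (-(g ω + k ω)) ∂μ ≠ ⊤ :=
    ((lintegral_mono fun ω => ENNReal.ofReal_le_ofReal (neg_le_neg (le_add_of_nonneg_left (hg0 ω)))).trans_lt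
      hk.neg.lintegral_lt_top).ne
  have hbal : ∫⁻ ω, ENNReal.ofReal (g ω + k ω) ∂μ + ∫⁻ ω, ENNReal.ofReal (-k ω) ∂μ =
      ∫⁻ ω, ENNReal.ofReal (g ω) ∂μ + ∫⁻ ω, ENNReal.ofReal (k ω) ∂μ +
        ∫⁻ ω, ENNReal.ofReal (-(g ω + k ω)) ∂μ := by
    have hkm := hk.1.aemeasurable
    rw [← lintegral_add_left' (f := fun ω => ENNReal.ofReal (g ω + k ω)) (hg.add hkm).ennreal_ofReal,
      ← lintegral_add_left' hg.ennreal_ofReal,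
      ← lintegral_add_left' (f := fun ω => ENNReal.ofReal (g ω) + ENNReal.ofReal (k ω))
        (hg.ennreal_ofReal.add hkm.ennreal_ofReal)]
    refine lintegral_congr fun ω => ?_
    have hG := hg0 ω
    have e : ∀ x : ℝ, ENNReal.ofReal x = ENNReal.ofReal (max x 0) := fun x => by
      rw [ENNReal.ofReal_max, ENNReal.ofReal_zero, max_eq_left zero_le]
    rw [e (g ω + k ω), e (-k ω), e (g ω), e (k ω), e (-(g ω + k ω)),
      ← ENNReal.ofReal_add (le_max_right _ _) (le_max_right _ _),
      ← ENNReal.ofReal_add (le_max_right _ _) (le_max_right _ _),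
      ← ENNReal.ofReal_add (by positivity) (le_max_right _ _)]
    congr 1
    grind
  rw [integral_eq_lintegral_pos_part_sub_lintegral_neg_part hk, extExpectation]
  generalize ∫⁻ ω, ENNReal.ofReal (g ω + k ω) ∂μ = a at *
  generalize ∫⁻ ω, ENNReal.ofReal (-(g ω + k ω)) ∂μ = b at *
  generalize ∫⁻ ω, ENNReal.ofReal (g ω) ∂μ = c at *
  generalize ∫⁻ ω, ENNReal.ofReal (k ω) ∂μ = p at *
  generalize ∫⁻ ω, ENNReal.ofReal (-k ω) ∂μ = q at *
  lift b to NNReal using hn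
  lift p to NNReal using hkp
  lift q to NNReal using hkn
  rcases eq_or_ne c ⊤ with rfl | hc
  · have ha : a = ⊤ := by
      by_contra ha
      lift a to NNReal using ha
      simp at hbal
    subst ha
    rfl
  · lift c to NNReal using hc
    have ha : a ≠ ⊤ := by
      rintro rfl
      rw [top_add] at hbal
      exact ENNReal.add_ne_top.2 ⟨ENNReal.add_ne_top.2 ⟨ENNReal.coe_ne_top,
        ENNReal.coe_ne_top⟩, ENNReal.coe_ne_top⟩ hbal.symm
    lift a to NNReal using ha
    have hr : (a : ℝ) + q = c + p + b := by exact_mod_cast hbal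
    change ((a : ℝ) : EReal) - ((b : ℝ) : EReal) = ((c : ℝ) : EReal) + (((p : ℝ) - q : ℝ) : EReal)
    rw [← EReal.coe_sub, ← EReal.coe_add, EReal.coe_eq_coe_iff]
    linarith

/-- Subtracting an affine minorant leaves a nonnegative convex function, handled by
`lintegral_comp_le_of_test`; the affine part contributes equally on both sides since the means
agree. -/
theorem extExpectation_comp_le_of_test {X Y : Ω → ℝ} (hX : Integrable X μ) (hY : Integrable Y μ)
    (h : ∀ φ, IsTestFunction φ → ∫ ω, φ (Y ω) ∂μ ≤ ∫ ω, φ (X ω) ∂μ)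
    {φ : ℝ → ℝ} (hφ : ConvexOn ℝ Set.univ φ) :
    extExpectation μ (fun ω => φ (Y ω)) ≤ extExpectation μ (fun ω => φ (X ω)) := by
  have hφc : Continuous φ := continuousOn_univ.1 (hφ.continuousOn isOpen_univ)
  obtain ⟨b, c, hbc⟩ := hφ.exists_affine_le_real isClosed_univ
    (hφc.lowerSemicontinuous.lowerSemicontinuousOn _)
  let g : ℝ → ℝ := fun x => φ x - (b * x + c)
  have hg0 : ∀ x, 0 ≤ g x := fun x => sub_nonneg.2 (hbc x (Set.mem_univ x))
  have hgc : Continuous g := by fun_prop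
  have hg : ConvexOn ℝ Set.univ g := by
    refine ⟨convex_univ, fun x hx y hy p q hp hq hpq => ?_⟩
    have := hφ.2 hx hy hp hq hpq
    simp only [smul_eq_mul, g] at this ⊢
    have hc : (p + q) * c = c := by rw [hpq, one_mul]
    linarith
  have hrep : ∀ {Z : Ω → ℝ}, Integrable Z μ → extExpectation μ (fun ω => φ (Z ω)) =
      ((∫⁻ ω, ENNReal.ofReal (g (Z ω)) ∂μ : ENNReal) : EReal) +
        ((∫ ω, (b * Z ω + c) ∂μ : ℝ) : EReal) := by
    intro Z hZ
    rw [← extExpectation_add (hgc.comp_aestronglyMeasurable hZ.1).aemeasurable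
      (fun ω => hg0 _) (k := fun ω => b * Z ω + c) ((hZ.const_mul b).add (integrable_const c))]
    simp [g]
  have hmean : ∫ ω, (b * Y ω + c) ∂μ = ∫ ω, (b * X ω + c) ∂μ := by
    rw [integral_add (hY.const_mul b) (integrable_const c),
      integral_add (hX.const_mul b) (integrable_const c), integral_const_mul, integral_const_mul,
      integral_eq_of_test hX hY h]
  rw [hrep hY, hrep hX, hmean]
  gcongr
  exact EReal.coe_ennreal_le_coe_ennreal_iff.2 (lintegral_comp_le_of_test hX hY h hg hg0)

end ConvexOrder

/-! ### Comonotonic improvement and the theorem. -/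

/-- Every clearing allocation is improved, in the convex order, by a comonotonic one. -/
theorem exists_comonotonic_improvement {Ω : Type*} [MeasurableSpace Ω] {μ : Measure Ω}
    [IsProbabilityMeasure μ] {n : ℕ} {S : Lp ℝ 1 μ} {X : Fin n → Lp ℝ 1 μ}
    (hX : X ∈ clearingAllocations n S) :
    ∃ Y ∈ comonotonicAllocations n S, ∀ i, ConvexOrder (Y i) (X i) := by
  rcases Nat.eq_zero_or_pos n with rfl | hn
  · exact ⟨X, ⟨hX, fun i => i.elim0, fun i => i.elim0, fun i => i.elim0⟩, fun i => i.elim0⟩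
  have : Nonempty (Fin n) := ⟨⟨0, hn⟩⟩
  have hXi : ∀ i, Integrable (X i) μ := fun i => L1.integrable_coeFn (X i)
  have hSi : Integrable S μ := L1.integrable_coeFn S
  obtain ⟨F, hF, hle⟩ := exists_isMonotoneSplit_forall hXi hSi hX
  have hFi : ∀ i, Integrable (fun ω => F (S ω) i) μ := fun i => hF.integrable_comp hSi i
  have hcoe : ∀ i, (hFi i).toL1 =ᵐ[μ] fun ω => F (S ω) i := fun i => (hFi i).coeFn_toL1
  refine ⟨fun i => (hFi i).toL1, ⟨?_, fun i s => F s i, fun i s t hst => hF.mono hst i, hcoe⟩,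
    fun i => ?_⟩
  · filter_upwards [ae_all_iff.2 hcoe] with ω hω
    simp only [hω, hF.sum_eq]
  · have htest : ∀ φ, IsTestFunction φ →
        ∫ ω, φ (((hFi i).toL1 : Lp ℝ 1 μ) ω) ∂μ ≤ ∫ ω, φ (X i ω) ∂μ := by
      intro φ hφ
      exact (integral_congr_ae ((hcoe i).fun_comp φ)).trans_le (hle i φ hφ)
    have hYi := L1.integrable_coeFn (hFi i).toL1
    exact ⟨integral_eq_of_test (hXi i) hYi htest,
      fun φ hφ => extExpectation_comp_le_of_test (hXi i) hYi htest hφ⟩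

end RiskSharing

theorem mainTheorem1 {Ω : Type*} [MeasurableSpace Ω] (μ : Measure Ω) [IsProbabilityMeasure μ]
    (hμ : RiskSharing.Atomless μ) (n : ℕ) (S : Lp ℝ 1 μ)
    (𝒳 : Set (Fin n → Lp ℝ 1 μ))
    (h𝒳 : 𝒳 ⊆ RiskSharing.clearingAllocations n S) (hne : 𝒳.Nonempty)
    (hsolid : RiskSharing.ConvexOrderSolid S 𝒳) :
    (∀ X ∈ 𝒳, ∃ X' ∈ 𝒳 ∩ RiskSharing.comonotonicAllocations n S,
      ∀ i, RiskSharing.ConvexOrder (X' i) (X i)) ∧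
    (∀ ρ : Fin n → Lp ℝ 1 μ → EReal, (∀ i, RiskSharing.ConvexOrderConsistent (ρ i)) →
      (⨅ X ∈ 𝒳, ∑ i, ρ i (X i)) =
        (⨅ X ∈ 𝒳 ∩ RiskSharing.comonotonicAllocations n S, ∑ i, ρ i (X i))) ∧
    (∀ ρ : Fin n → Lp ℝ 1 μ → EReal, (∀ i, RiskSharing.ConvexOrderConsistent (ρ i)) →
      ∀ X ∈ 𝒳, RiskSharing.ParetoOptimal ρ 𝒳 X →
        ∃ X' ∈ 𝒳 ∩ RiskSharing.comonotonicAllocations n S,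
          ∀ i, ρ i (X' i) = ρ i (X i)) := by
  have himp : ∀ X ∈ 𝒳, ∃ X' ∈ 𝒳 ∩ RiskSharing.comonotonicAllocations n S,
      ∀ i, RiskSharing.ConvexOrder (X' i) (X i) := by
    intro X hX
    obtain ⟨Y, hY, hYX⟩ := RiskSharing.exists_comonotonic_improvement (h𝒳 hX)
    exact ⟨Y, ⟨hsolid X hX Y hY.1 hYX, hY⟩, hYX⟩
  refine ⟨himp, fun ρ hρ => le_antisymm ?_ ?_, fun ρ hρ X hX hpar => ?_⟩
  · exact biInf_mono fun X hX => hX.1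
  · refine le_iInf₂ fun X hX => ?_
    obtain ⟨Y, hY, hYX⟩ := himp X hX
    exact (iInf₂_le Y hY).trans (Finset.sum_le_sum fun i _ => (hρ i).mono _ _ (hYX i))
  · obtain ⟨Y, hY, hYX⟩ := himp X hX
    have hle : ∀ i, ρ i (Y i) ≤ ρ i (X i) := fun i => (hρ i).mono _ _ (hYX i)
    refine ⟨Y, hY, fun i => (hle i).antisymm (not_lt.1 fun hlt => ?_)⟩
    -- A strict inequality in one coordinate would make `Y` a Pareto improvement within `𝒳`.
    exact hpar.2 ⟨Y, hY.1, hle, i, hlt⟩
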